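/- Let $(\Omega,\mathcal F,\mu)$ be a probability space and let $T:\Omega\to\Omega$ be a bijective, bi-measurable, measure preserving and ergodic map. Assume that $T$ is aperiodic: for every $n\ge 1$ and every $A\in\mathcal F$ with $\mu(A)>0$ there is a measurable $B\subseteq A$ with $\mu(B\,\triangle\,T^{-n}B)>0$ (if $\mathcal F$ contains a countable family separating the points, for instance on a standard Borel space, this means that the set of periodic points of $T$ is $\mu$-null). For measurable $f:\Omega\to\mathbb R$ put $S_n(f)=\sum_{j=0}^{n-1}f\circ T^j$ and, for $t\in[0,1]$, $S_n^{\mathrm{pl}}(f,t)=S_{[nt]}(f)+(nt-[nt])\,f\circ T^{[nt]}$, where $[x]$ is the integer part of $x$. Say that $f$ satisfies * the invariance principle if the sequence $(n^{-1/2}S_n^{\mathrm{pl}}(f,\cdot))_{n\ge1}$ converges in distribution, in $C[0,1]$ with the uniform topology, to $c\,W$ for some real constant $c$ (possibly $0$) and a standard Brownian motion $W$ on $[0,1]$; * the law of the iterated logarithm if there is a real constant $C$ (possibly $0$) such that, for almost every $\omega\in\Omega$, $$\limsup_{n\to\infty}\frac{S_n(f)(\omega)}{\sqrt{n\log\log n}}=C\quad\text{and}\quad\liminf_{n\to\infty}\frac{S_n(f)(\omega)}{\sqrt{n\log\log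 n}}=-C .$$ **Theorem 2.10.** Let $1\le p<2\le r$ be real numbers such that $p<r/(r-1)$. Then there exists a measurable function $g:\Omega\to\mathbb R$ with $g\in\mathbb L^p(\mu)$ such that $g-g\circ T\in\mathbb L^r(\mu)$ and $g-g\circ T$ satisfies neither the invariance principle nor the law of the iterated logarithm. -/

import Mathlib

open MeasureTheory ProbabilityTheory Filter Topology
open scoped ENNReal unitInterval

noncomputable section

namespace CoboundaryLimit

/-- The space `C[0,1]` with its Borel σ-algebra (for the uniform topology). -/
instance instMeasurableSpacePaths : MeasurableSpace C(I, ℝ) := borel _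

instance instBorelSpacePaths : BorelSpace C(I, ℝ) := ⟨rfl⟩

section Aperiodic

variable {Ω : Type*} [MeasurableSpace Ω]

/-- `T` is aperiodic for `μ`: for every `n ≥ 1`, the iterate `T ^ n` does not act as the identity
(modulo null sets) on the measurable subsets of any set of positive measure.
On spaces whose σ-algebra separates points countably (in particular on standard Borel and on
Lebesgue spaces) this says that the set of periodic points is null, see `isAperiodic_iff`;
the formulation through sets is the one that is meaningful on an arbitrary probability space. -/
def IsAperiodic (μ : Measure Ω) (T : Ω → Ω) : Prop :=
  ∀ n : ℕ, 1 ≤ n → ∀ A : Set Ω, MeasurableSet A → μ A ≠ 0 →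
    ∃ B ⊆ A, MeasurableSet B ∧ μ (symmDiff B (T^[n] ⁻¹' B)) ≠ 0

/-- On a countably separated space, aperiodicity of an injective map means that almost no point is periodic. -/
theorem isAperiodic_iff [MeasurableSpace.CountablySeparated Ω] (μ : Measure Ω) {T : Ω → Ω}
    (hT : Measurable T) (hinj : Function.Injective T) :
    IsAperiodic μ T ↔ μ {ω | ∃ n : ℕ, 1 ≤ n ∧ T^[n] ω = ω} = 0 := by
  obtain ⟨S, hSc, hSm, hS⟩ :=
    (inferInstance : HasCountableSeparatingOn Ω MeasurableSet Set.univ).exists_countable_separating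
  have hmeas : ∀ n, MeasurableSet {ω | T^[n] ω = ω} := by
    intro n
    have : {ω | T^[n] ω = ω} = ⋂ E ∈ S, {ω | T^[n] ω ∈ E ↔ ω ∈ E} := by
      ext ω
      simp only [Set.mem_ofPred_eq, Set.mem_iInter]
      exact ⟨fun h E _ ↦ by rw [h], fun h ↦ hS _ (Set.mem_univ _) _ (Set.mem_univ _) h⟩
    rw [this]
    refine MeasurableSet.biInter hSc fun E hE ↦ ?_
    have h1 : Measurable fun ω ↦ T^[n] ω ∈ E := (hSm E hE).mem.comp (hT.iterate n)
    exact measurableSet_setOfPred.2 (h1.iff (hSm E hE).mem)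
  have hU : {ω | ∃ n : ℕ, 1 ≤ n ∧ T^[n] ω = ω} = ⋃ n, ⋃ _ : 1 ≤ n, {ω | T^[n] ω = ω} := by
    ext ω; simp
  rw [hU]
  simp only [measure_iUnion_null_iff]
  constructor
  · intro h n hn
    by_contra hA
    obtain ⟨B, hBA, -, hB⟩ := h n hn _ (hmeas n) hA
    apply hB
    have h1 : T^[n] ⁻¹' B = B := by
      ext ω
      refine ⟨fun h ↦ ?_, fun h ↦ ?_⟩
      · have h2 : T^[n] (T^[n] ω) = T^[n] ω := hBA h
        have h3 : T^[n] ω = ω := hinj.iterate n h2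
        rwa [Set.mem_preimage, h3] at h
      · have h3 : T^[n] ω = ω := hBA h
        rwa [Set.mem_preimage, h3]
    simp [h1]
  · intro h n hn A hA hA0
    by_contra hcon
    push Not at hcon
    apply hA0
    have hsub : A ⊆ {ω | T^[n] ω = ω} ∪ ⋃ E ∈ S,
        (symmDiff (A ∩ E) (T^[n] ⁻¹' (A ∩ E)) ∪ symmDiff (A ∩ Eᶜ) (T^[n] ⁻¹' (A ∩ Eᶜ))) := by
      intro ω hω
      by_cases hp : T^[n] ω = ω
      · exact Or.inl hp
      · right
        have : ∃ E ∈ S, ¬ (T^[n] ω ∈ E ↔ ω ∈ E) := by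
          by_contra hc
          push Not at hc
          exact hp (hS _ (Set.mem_univ _) _ (Set.mem_univ _) hc)
        obtain ⟨E, hE, hne⟩ := this
        simp only [Set.mem_iUnion]
        refine ⟨E, hE, ?_⟩
        by_cases hωE : ω ∈ E
        · left; left
          refine ⟨⟨hω, hωE⟩, fun hc ↦ hne ⟨fun _ ↦ hωE, fun _ ↦ hc.2⟩⟩
        · right; left
          refine ⟨⟨hω, hωE⟩, fun hc ↦ hne ⟨fun h ↦ absurd h hc.2, fun h ↦ absurd h hωE⟩⟩
    refine measure_mono_null hsub (measure_union_null (h n hn) ?_)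
    refine (measure_biUnion_null_iff hSc).2 fun E hE ↦ measure_union_null ?_ ?_
    · exact hcon _ Set.inter_subset_left (hA.inter (hSm E hE))
    · exact hcon _ Set.inter_subset_left (hA.inter (hSm E hE).compl)

end Aperiodic

section Polygonal

/-- The polygonal line through the points `(k, a 0 + ⋯ + a (k - 1))`, at the abscissa `x ≥ 0`. -/
def polygon (a : ℕ → ℝ) (x : ℝ) : ℝ :=
  ∑ j ∈ Finset.range ⌊x⌋₊, a j + (x - ⌊x⌋₊) * a ⌊x⌋₊

theorem polygon_eq_sum (a : ℕ → ℝ) (n : ℕ) {x : ℝ} (h0 : 0 ≤ x) (hn : x ≤ n) :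
    polygon a x = ∑ j ∈ Finset.range (n + 1), a j * max 0 (min 1 (x - j)) := by
  have hf : ⌊x⌋₊ ≤ n := Nat.floor_le_of_le hn
  have h1 : (⌊x⌋₊ : ℝ) ≤ x := Nat.floor_le h0
  have h2 : x < ⌊x⌋₊ + 1 := Nat.lt_floor_add_one x
  have hsub : Finset.range (⌊x⌋₊ + 1) ⊆ Finset.range (n + 1) :=
    Finset.range_subset_range.2 (by omega)
  rw [← Finset.sum_subset hsub, Finset.sum_range_succ, polygon]
  · congr 1
    · refine Finset.sum_congr rfl fun j hj ↦ ?_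
      have : ((j + 1 : ℕ) : ℝ) ≤ ⌊x⌋₊ := Nat.cast_le.2 (Finset.mem_range.1 hj)
      push_cast at this
      rw [min_eq_left (by linarith), max_eq_right zero_le_one, mul_one]
    · rw [min_eq_right (by linarith), max_eq_right (by linarith), mul_comm]
  · intro j _ hj
    have : ((⌊x⌋₊ + 1 : ℕ) : ℝ) ≤ j := by
      have := Finset.mem_range.not.1 hj
      exact Nat.cast_le.2 (by omega)
    push_cast at this
    rw [max_eq_left ((min_le_right _ _).trans (by linarith)), mul_zero]

theorem polygon_mul_eq_sum (a : ℕ → ℝ) (n : ℕ) (t : I) :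
    polygon a (n * t) = ∑ j ∈ Finset.range (n + 1), a j * max 0 (min 1 (n * (t : ℝ) - j)) :=
  polygon_eq_sum a n (mul_nonneg n.cast_nonneg t.2.1)
    (mul_le_of_le_one_right n.cast_nonneg t.2.2)

theorem continuous_polygon (a : ℕ → ℝ) (n : ℕ) : Continuous fun t : I ↦ polygon a (n * t) := by
  simp only [polygon_mul_eq_sum]
  fun_prop

variable {Ω : Type*}

/-- The partial-sum process `t ↦ S_{[nt]}(f) + (nt - [nt]) f ∘ T^{[nt]}`, as an element of
`C[0,1]`, at the point `ω`. -/
def partialSumPath (T : Ω → Ω) (f : Ω → ℝ) (n : ℕ) (ω : Ω) : C(I, ℝ) where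
  toFun t := polygon (fun j ↦ f (T^[j] ω)) (n * t)
  continuous_toFun := continuous_polygon _ n

theorem partialSumPath_apply (T : Ω → Ω) (f : Ω → ℝ) (n : ℕ) (ω : Ω) (t : I) :
    partialSumPath T f n ω t = birkhoffSum T f ⌊(n : ℝ) * t⌋₊ ω
      + ((n : ℝ) * t - ⌊(n : ℝ) * t⌋₊) * f (T^[⌊(n : ℝ) * t⌋₊] ω) :=
  rfl

/-- The partial-sum process is a random element of `C[0,1]`, so that its law makes sense. -/
theorem measurable_partialSumPath [MeasurableSpace Ω] {T : Ω → Ω} (hT : Measurable T)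
    {f : Ω → ℝ} (hf : Measurable f) (n : ℕ) : Measurable (partialSumPath T f n) := by
  let φ : ℕ → C(I, ℝ) := fun j ↦ ⟨fun t ↦ max 0 (min 1 ((n : ℝ) * t - j)), by fun_prop⟩
  have h : partialSumPath T f n =
      fun ω ↦ ∑ j ∈ Finset.range (n + 1), f (T^[j] ω) • φ j := by
    ext ω t
    simp [partialSumPath, polygon_mul_eq_sum, φ]
  rw [h]
  refine Finset.measurable_sum _ fun j _ ↦ ?_
  have hc : Continuous fun c : ℝ ↦ c • φ j := by fun_prop
  exact hc.measurable.comp (hf.comp (hT.iterate j))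

end Polygonal

section LimitTheorems

variable {Ω : Type*} [MeasurableSpace Ω]

/-- `W` is the law on `C[0,1]` of a standard Brownian motion: under `W`, the coordinate process is
a centred Gaussian process with covariance `min s t`. -/
structure IsWiener (W : Measure C(I, ℝ)) : Prop where
  isGaussianProcess : IsGaussianProcess (fun (t : I) (x : C(I, ℝ)) ↦ x t) W
  integral_eq_zero : ∀ t : I, ∫ x, x t ∂W = 0
  covariance_eq : ∀ s t : I,
    cov[fun x : C(I, ℝ) ↦ x s, fun x : C(I, ℝ) ↦ x t; W] = min (s : ℝ) (t : ℝ)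

/-- The invariance principle: the processes `n^{-1/2} S_n^{pl}(f, ·)` converge in distribution in
`C[0,1]` to a scalar multiple `c • W` of a standard Brownian motion (`c = 0` is allowed). -/
def InvariancePrinciple (μ : Measure Ω) [IsProbabilityMeasure μ] (T : Ω → Ω) (f : Ω → ℝ) : Prop :=
  ∃ (c : ℝ) (W : Measure C(I, ℝ)) (_ : IsProbabilityMeasure W), IsWiener W ∧
    TendstoInDistribution (fun (n : ℕ) ω ↦ (√(n : ℝ))⁻¹ • partialSumPath T f n ω) atTop
      (fun x : C(I, ℝ) ↦ c • x) (fun _ ↦ μ) W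

/-- The law of the iterated logarithm: for some real constant `C` (`C = 0` is allowed), almost
surely the upper and lower limits (in the extended reals) of `S_n(f) / √(n log log n)` are `C`
and `-C`. -/
def LawOfIteratedLogarithm (μ : Measure Ω) (T : Ω → Ω) (f : Ω → ℝ) : Prop :=
  ∃ C : ℝ, ∀ᵐ ω ∂μ,
    limsup (fun n : ℕ ↦
      ((birkhoffSum T f n ω / √(n * Real.log (Real.log n)) : ℝ) : EReal)) atTop = (C : EReal) ∧
    liminf (fun n : ℕ ↦
      ((birkhoffSum T f n ω / √(n * Real.log (Real.log n)) : ℝ) : EReal)) atTop = ((-C : ℝ) : EReal)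

end LimitTheorems

end CoboundaryLimit

end

/-!
The Birkhoff sums of a coboundary are `S_j = g - g ∘ T^j`. Both limit theorems fail as soon as,
for some times `n k → ∞`, the maximum of `g ∘ T^j` over `j < n k` is almost surely much larger
than `√(n k log log (n k))`. Indeed the uniform norm of the normalized partial-sum process then
tends almost surely to infinity along `n k`, so that these processes are not tight
(`not_invariancePrinciple`), and the lower limit in the law of the iterated logarithm is `-∞`
(`not_lawOfIteratedLogarithm`).

To obtain such a `g`, let `B` be a set of measure at most `2 / n` that almost every orbit visits
before time `n`; it exists by a weak form of Rokhlin's lemma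
(`exists_measure_le_ae_exists_iterate_mem`). Over `B` put a tent of height about `n ^ b`, with
`b > 1 / 2`, which along each orbit climbs to its peak and descends again in about `n ^ a` steps.
Its `p`-th moment is at most of order `n ^ (b * p + a - 1)`, and its increments have `r`-th moment
at most of order `n ^ ((b - a) * r + a - 1)`. Exponents `a > 0` and `b > 1 / 2` for which both of
these tend to zero exist because `p < r / (r - 1)` (`exists_exponents`).

Finally `g` is the supremum of a sequence of such tents, at scales along which the two moments are
summable (`exists_transfer_function`). A supremum, unlike a signed sum, involves no cancellation:
`g` is at least as large as each tent, and `|g - g ∘ T|` is at most the supremum of the increments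
of the tents.
-/

namespace CoboundaryLimit

/-! ### Sets of small measure and sweeping sets -/

section Sweeping

variable {Ω : Type*} {T : Ω → Ω}

/-- The set of points whose first visit to `A`, the starting point included, takes place at
time `m`. -/
def firstVisit (T : Ω → Ω) (A : Set Ω) (m : ℕ) : Set Ω :=
  disjointed (fun m ↦ T^[m] ⁻¹' A) m

theorem mem_firstVisit {A : Set Ω} {m : ℕ} {x : Ω} :
    x ∈ firstVisit T A m ↔ T^[m] x ∈ A ∧ ∀ j < m, T^[j] x ∉ A := by
  simp [firstVisit, disjointed_eq_inter_compl]

theorem iterate_mem_firstVisit {A : Set Ω} {m i : ℕ} {x : Ω} (hx : x ∈ firstVisit T A (m + i)) :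
    T^[i] x ∈ firstVisit T A m := by
  rw [mem_firstVisit] at hx ⊢
  simp only [← Function.iterate_add_apply]
  exact ⟨hx.1, fun j hj ↦ hx.2 _ (by omega)⟩

variable [MeasurableSpace Ω]

theorem measurableSet_firstVisit (hT : Measurable T) {A : Set Ω} (hA : MeasurableSet A) (m : ℕ) :
    MeasurableSet (firstVisit T A m) :=
  MeasurableSet.disjointed (fun m ↦ hT.iterate m hA) m

variable {μ : Measure Ω} [IsProbabilityMeasure μ]

/-- Aperiodicity excludes atoms: by Poincaré recurrence, an atom `A` is invariant modulo null sets
under some iterate `T^[n]` with `n ≥ 1`, and then so is each of its measurable subsets. -/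
theorem IsAperiodic.exists_subset_measure_le_half (haper : IsAperiodic μ T)
    (hT : MeasurePreserving T μ μ) {A : Set Ω} (hA : MeasurableSet A) (hA0 : μ A ≠ 0) :
    ∃ B ⊆ A, MeasurableSet B ∧ μ B ≠ 0 ∧ μ B ≤ μ A / 2 := by
  by_contra! hcon
  have hatom : ∀ B ⊆ A, MeasurableSet B → μ B = 0 ∨ μ (A \ B) = 0 := by
    intro B hBA hB
    by_contra! h
    have h1 := hcon B hBA hB h.1
    have h2 := hcon (A \ B) Set.sdiff_subset (hA.diff hB) h.2
    have h3 := ENNReal.add_lt_add h1 h2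
    have h4 := measure_inter_add_sdiff (μ := μ) A hB
    rw [Set.inter_eq_right.2 hBA] at h4
    rw [ENNReal.add_halves, h4] at h3
    exact lt_irrefl _ h3
  obtain ⟨n, hn, hrec⟩ := hT.conservative.exists_gt_measure_inter_ne_zero hA.nullMeasurableSet hA0 0
  have hTn : MeasurePreserving T^[n] μ μ := hT.iterate n
  have hAinv : μ (A \ T^[n] ⁻¹' A) = 0 := by
    rw [← Set.sdiff_inter_self_eq_sdiff, Set.inter_comm]
    exact (hatom _ Set.inter_subset_left (hA.inter (hTn.measurable hA))).resolve_left hrec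
  obtain ⟨B, hBA, hB, hBne⟩ := haper n hn A hA hA0
  refine hBne (measure_symmDiff_eq_zero_iff.2 ?_)
  refine ae_eq_of_ae_subset_of_measure_ge ?_ (hTn.measure_preimage hB.nullMeasurableSet).le
    hB.nullMeasurableSet (measure_ne_top _ _)
  rw [ae_le_set]
  rcases hatom B hBA hB with h | h
  · exact measure_mono_null Set.sdiff_subset h
  · have h' : μ (T^[n] ⁻¹' (A \ B)) = 0 := by
      rwa [hTn.measure_preimage (hA.diff hB).nullMeasurableSet]
    refine measure_mono_null ?_ (measure_union_null hAinv h')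
    intro x hx
    by_cases hxA : T^[n] x ∈ A
    · exact Or.inr ⟨hxA, hx.2⟩
    · exact Or.inl ⟨hBA hx.1, hxA⟩

theorem IsAperiodic.exists_measure_le (haper : IsAperiodic μ T) (hT : MeasurePreserving T μ μ)
    {ε : ℝ≥0∞} (hε : ε ≠ 0) : ∃ A, MeasurableSet A ∧ μ A ≠ 0 ∧ μ A ≤ ε := by
  have key : ∀ n : ℕ, ∃ A, MeasurableSet A ∧ μ A ≠ 0 ∧ μ A ≤ (2⁻¹ : ℝ≥0∞) ^ n := by
    intro n
    induction n with
    | zero => exact ⟨Set.univ, .univ, by simp, by simp⟩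
    | succ n ih =>
      obtain ⟨A, hA, hA0, hAn⟩ := ih
      obtain ⟨B, -, hB, hB0, hBA⟩ := haper.exists_subset_measure_le_half hT hA hA0
      refine ⟨B, hB, hB0, hBA.trans ?_⟩
      rw [pow_succ, div_eq_mul_inv]
      gcongr
  obtain ⟨n, hn⟩ := ENNReal.exists_inv_two_pow_lt hε
  obtain ⟨A, hA, hA0, hAn⟩ := key n
  exact ⟨A, hA, hA0, hAn.trans hn.le⟩

/-- In an ergodic system almost every point visits a given set of positive measure. -/
theorem ae_exists_mem_firstVisit (hT : Ergodic T μ) {A : Set Ω} (hA : MeasurableSet A)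
    (hA0 : μ A ≠ 0) : ∀ᵐ x ∂μ, ∃ m, x ∈ firstVisit T A m := by
  have hm : MeasurableSet (⋃ m, T^[m] ⁻¹' A) :=
    .iUnion fun m ↦ hT.measurable.iterate m hA
  have hsub : T ⁻¹' (⋃ m, T^[m] ⁻¹' A) ⊆ ⋃ m, T^[m] ⁻¹' A := by
    intro x hx
    simp only [Set.mem_preimage, Set.mem_iUnion] at hx ⊢
    obtain ⟨m, hm⟩ := hx
    exact ⟨m + 1, hm⟩
  rcases hT.ae_empty_or_univ_of_preimage_ae_le hm.nullMeasurableSet hsub.eventuallyLE with h | h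
  · refine absurd (measure_mono_null ?_ (ae_eq_empty.1 h)) hA0
    exact fun x hx ↦ Set.mem_iUnion.2 ⟨0, hx⟩
  · rw [← iUnion_disjointed] at h
    filter_upwards [eventuallyEq_univ.1 h] with x hx
    exact Set.mem_iUnion.1 hx

/-- A weak form of Rokhlin's lemma. The set consists of the points whose first visit to a very
small set happens at a time divisible by `N`; the residue of the time of first visit modulo `N`
decreases by one along orbits, so that every residue has about the same probability. -/
theorem exists_measure_le_ae_exists_iterate_mem (hT : Ergodic T μ) (haper : IsAperiodic μ T)
    {N : ℕ} (hN : 0 < N) :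
    ∃ B, MeasurableSet B ∧ μ B ≤ 2 / N ∧ ∀ᵐ x ∂μ, ∃ j < N, T^[j] x ∈ B := by
  have hN0 : (N : ℝ≥0∞) ≠ 0 := by exact_mod_cast hN.ne'
  have hNt : (N : ℝ≥0∞) ≠ ∞ := ENNReal.natCast_ne_top N
  obtain ⟨A, hA, hA0, hAN⟩ := haper.exists_measure_le hT.toMeasurePreserving
    (ε := (N : ℝ≥0∞)⁻¹) (ENNReal.inv_ne_zero.2 hNt)
  have hD := measurableSet_firstVisit hT.measurable hA
  -- `E i`: the first visit takes place at a positive time congruent to `i + 1` modulo `N`; the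
  -- positive multiples of `N` are those of `E (N - 1)`.
  let E : ℕ → Set Ω := fun i ↦ ⋃ k, firstVisit T A (k * N + (i + 1))
  have hE : ∀ i, MeasurableSet (E i) := fun i ↦ .iUnion fun k ↦ hD _
  have hEle : ∀ i ∈ Finset.range N, μ (E (N - 1)) ≤ μ (E i) := by
    intro i hi
    rw [Finset.mem_range] at hi
    have hmp := hT.toMeasurePreserving.iterate (N - 1 - i)
    rw [← hmp.measure_preimage (hE i).nullMeasurableSet]
    refine measure_mono fun x hx ↦ ?_
    obtain ⟨k, hk⟩ := Set.mem_iUnion.1 hx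
    refine Set.mem_iUnion.2 ⟨k, iterate_mem_firstVisit ?_⟩
    have heq : k * N + (i + 1) + (N - 1 - i) = k * N + (N - 1 + 1) := by omega
    rwa [heq]
  have hdisj : Set.PairwiseDisjoint (↑(Finset.range N)) E := by
    intro i hi i' hi' hne
    rw [Function.onFun, Set.disjoint_iff]
    rintro x ⟨hx, hx'⟩
    obtain ⟨k, hk⟩ := Set.mem_iUnion.1 hx
    obtain ⟨k', hk'⟩ := Set.mem_iUnion.1 hx'
    have heq : k * N + (i + 1) = k' * N + (i' + 1) := by
      by_contra h
      exact Set.disjoint_iff.1 (disjoint_disjointed (fun m ↦ T^[m] ⁻¹' A) h) ⟨hk, hk'⟩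
    apply hne
    simp only [Finset.coe_range, Set.mem_Iio] at hi hi'
    have h1 : (k * N + i) % N = (k' * N + i') % N := by congr 1; omega
    rwa [Nat.mul_add_mod_self_right, Nat.mul_add_mod_self_right, Nat.mod_eq_of_lt hi,
      Nat.mod_eq_of_lt hi'] at h1
  have hElast : μ (E (N - 1)) ≤ (N : ℝ≥0∞)⁻¹ := by
    rw [ENNReal.le_inv_iff_mul_le, mul_comm]
    calc (N : ℝ≥0∞) * μ (E (N - 1)) = ∑ i ∈ Finset.range N, μ (E (N - 1)) := by simp
      _ ≤ ∑ i ∈ Finset.range N, μ (E i) := Finset.sum_le_sum hEle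
      _ = μ (⋃ i ∈ Finset.range N, E i) :=
        (measure_biUnion_finset hdisj fun i _ ↦ hE i).symm
      _ ≤ 1 := prob_le_one
  refine ⟨⋃ k, firstVisit T A (k * N), .iUnion fun k ↦ hD _, ?_, ?_⟩
  · have hsub : (⋃ k, firstVisit T A (k * N)) ⊆ A ∪ E (N - 1) := by
      refine Set.iUnion_subset fun k x hx ↦ ?_
      rcases k with _ | k
      · left
        simpa using (mem_firstVisit.1 hx).1
      · right
        refine Set.mem_iUnion.2 ⟨k, ?_⟩
        convert hx using 1
        rw [Nat.sub_add_cancel hN, Nat.succ_mul]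
    calc _ ≤ μ A + μ (E (N - 1)) := (measure_mono hsub).trans (measure_union_le _ _)
      _ ≤ (N : ℝ≥0∞)⁻¹ + (N : ℝ≥0∞)⁻¹ := add_le_add hAN hElast
      _ = 2 / N := by rw [div_eq_mul_inv, two_mul]
  -- If the first visit to `A` takes place at time `m`, the orbit is in the set at time `m % N`.
  · filter_upwards [ae_exists_mem_firstVisit hT hA hA0] with x ⟨m, hm⟩
    refine ⟨m % N, Nat.mod_lt _ hN, Set.mem_iUnion.2 ⟨m / N, iterate_mem_firstVisit ?_⟩⟩
    rwa [mul_comm, Nat.div_add_mod]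

end Sweeping

/-! ### Tents along orbits -/

section Tent

variable {Ω : Type*} {T : Ω → Ω}

open Classical in
/-- The tent of height `L` over the set `B`: the value at `x` is the largest of the numbers
`min j (2 * L - j)` over the times `j ≤ 2 * L` at which the orbit of `x` is in `B`, and `0` if
there is no such time. -/
noncomputable def tent (T : Ω → Ω) (B : Set Ω) (L : ℕ) (x : Ω) : ℕ :=
  (Finset.range (2 * L + 1)).sup fun j ↦ if T^[j] x ∈ B then min j (2 * L - j) else 0

/-- The points whose orbit visits `B` before time `n`. -/
def visitBefore (T : Ω → Ω) (B : Set Ω) (n : ℕ) : Set Ω :=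
  ⋃ j ∈ Finset.range n, T^[j] ⁻¹' B

variable {B : Set Ω} {L : ℕ} {x : Ω}

theorem tent_le_iff {a : ℕ} :
    tent T B L x ≤ a ↔ ∀ j ≤ 2 * L, T^[j] x ∈ B → min j (2 * L - j) ≤ a := by
  simp only [tent, Finset.sup_le_iff, Finset.mem_range, Nat.lt_succ_iff]
  refine forall₂_congr fun j _ ↦ ?_
  split_ifs with h <;> simp [h]

theorem min_le_tent {j : ℕ} (hj : T^[j] x ∈ B) : min j (2 * L - j) ≤ tent T B L x := by
  rcases le_or_gt j (2 * L) with h | h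
  · exact tent_le_iff.1 le_rfl j h hj
  · simp [Nat.sub_eq_zero_of_le h.le]

theorem tent_le : tent T B L x ≤ L :=
  tent_le_iff.2 fun j _ _ ↦ by omega

theorem tent_eq_of_iterate_mem (h : T^[L] x ∈ B) : tent T B L x = L :=
  tent_le.antisymm (by simpa [two_mul] using min_le_tent (L := L) h)

theorem tent_le_tent_apply_add_one : tent T B L x ≤ tent T B L (T x) + 1 := by
  refine tent_le_iff.2 fun j _ hj ↦ ?_
  rcases j with _ | j
  · simp
  · have := min_le_tent (T := T) (B := B) (L := L) (x := T x) (j := j) hj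
    omega

theorem tent_apply_le_tent_add_one : tent T B L (T x) ≤ tent T B L x + 1 := by
  refine tent_le_iff.2 fun j _ hj ↦ ?_
  have := min_le_tent (T := T) (B := B) (L := L) (x := x) (j := j + 1) hj
  omega

theorem tent_eq_zero (hx : x ∉ visitBefore T B (2 * L + 1)) : tent T B L x = 0 := by
  refine Nat.le_zero.1 (tent_le_iff.2 fun j hj hjB ↦ absurd ?_ hx)
  exact Set.mem_biUnion (by simpa [Nat.lt_succ_iff] using hj) hjB

theorem tent_apply_eq_zero (hx : x ∉ visitBefore T B (2 * L + 1)) : tent T B L (T x) = 0 := by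
  refine Nat.le_zero.1 (tent_le_iff.2 fun j hj hjB ↦ ?_)
  rcases hj.eq_or_lt with rfl | hlt
  · simp
  · refine absurd (Set.mem_biUnion (x := j + 1) ?_ hjB) hx
    simpa using hlt

variable [MeasurableSpace Ω]

theorem measurable_tent (hT : Measurable T) (hB : MeasurableSet B) :
    Measurable (tent T B L) := by
  refine measurable_of_Iic fun a ↦ ?_
  have : tent T B L ⁻¹' Set.Iic a =
      ⋂ j, ⋂ _ : j ≤ 2 * L, {x | T^[j] x ∈ B → min j (2 * L - j) ≤ a} := by
    ext x
    simp [tent_le_iff]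
  rw [this]
  refine .iInter fun j ↦ .iInter fun _ ↦ ?_
  exact measurableSet_setOfPred.2 (((hB.mem.comp (hT.iterate j))).imp measurable_const)

theorem measurableSet_visitBefore (hT : Measurable T) (hB : MeasurableSet B) (n : ℕ) :
    MeasurableSet (visitBefore T B n) :=
  Finset.measurableSet_biUnion _ fun j _ ↦ hT.iterate j hB

theorem measure_visitBefore_le {μ : Measure Ω} (hT : MeasurePreserving T μ μ)
    (hB : MeasurableSet B) (n : ℕ) : μ (visitBefore T B n) ≤ n * μ B := by
  refine (measure_biUnion_finset_le _ _).trans ?_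
  simp [fun j ↦ (hT.iterate j).measure_preimage hB.nullMeasurableSet]

end Tent

/-! ### The choice of the parameters -/

section Parameters

/-- The condition `p < r / (r - 1)` in the form in which it is used: with a tent of height
`n ^ b` and width `n ^ a` over a set of measure of order `1 / n`, the two last inequalities
make the `L^p`-norm of the tent and the `L^r`-norm of its increments tend to zero. -/
theorem exists_exponents {p r : ℝ} (hp : 0 < p) (hr : 2 ≤ r) (hpr : p < r / (r - 1)) :
    ∃ a b : ℝ, 0 < a ∧ 1 / 2 < b ∧ b * p + a < 1 ∧ (b - a) * r + a < 1 := by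
  have hr1 : 0 < r - 1 := by linarith
  rw [lt_div_iff₀ hr1] at hpr
  have hpos : 0 < p * (r - 1) + r := by positivity
  obtain ⟨b, hb, hb'⟩ : ∃ b, 1 / 2 < b ∧ b < r / (p * (r - 1) + r) :=
    exists_between (by rw [div_lt_div_iff₀ two_pos hpos]; linarith)
  rw [lt_div_iff₀ hpos] at hb'
  obtain ⟨a, ha, ha'⟩ : ∃ a, (r * b - 1) / (r - 1) < a ∧ a < 1 - b * p :=
    exists_between (by rw [div_lt_iff₀ hr1]; nlinarith)
  have h0 : 0 < (r * b - 1) / (r - 1) := div_pos (by nlinarith) hr1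
  refine ⟨a, b, h0.trans ha, hb, by linarith, ?_⟩
  rw [div_lt_iff₀ hr1] at ha
  linarith

theorem eventually_mul_sqrt_mul_log_log_le_rpow {b : ℝ} (hb : 1 / 2 < b) (K : ℝ) :
    ∀ᶠ n : ℕ in atTop, K * √(n * Real.log (Real.log n)) ≤ (n : ℝ) ^ b := by
  have hs : 0 < 2 * b - 1 := by linarith
  have h1 := (isLittleO_log_rpow_atTop hs).bound (c := (K ^ 2 + 1)⁻¹) (by positivity)
  filter_upwards [tendsto_natCast_atTop_atTop.eventually h1, eventually_ge_atTop 3] with n hn h3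
  have h3' : (3 : ℝ) ≤ n := by exact_mod_cast h3
  have hn0 : (0 : ℝ) < n := by linarith
  have hlog : 0 ≤ Real.log n := Real.log_nonneg (by linarith)
  rw [Real.norm_of_nonneg hlog, Real.norm_of_nonneg (by positivity)] at hn
  have hll : Real.log (Real.log n) ≤ Real.log n := Real.log_le_self hlog
  refine (mul_le_mul_of_nonneg_right (le_abs_self K) (Real.sqrt_nonneg _)).trans ?_
  rw [← Real.sqrt_sq_eq_abs, ← Real.sqrt_mul (sq_nonneg K)]
  refine Real.sqrt_le_iff.2 ⟨by positivity, ?_⟩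
  have hpow : ((n : ℝ) ^ b) ^ 2 = n * (n : ℝ) ^ (2 * b - 1) := by
    rw [← Real.rpow_natCast, ← Real.rpow_mul hn0.le, Real.rpow_sub_one hn0.ne']
    field_simp
    norm_num [mul_comm]
  rw [hpow]
  calc K ^ 2 * (n * Real.log (Real.log n)) ≤ (K ^ 2 + 1) * (n * Real.log n) := by
        have : (n : ℝ) * Real.log (Real.log n) ≤ n * Real.log n := by gcongr
        have : 0 ≤ (n : ℝ) * Real.log n := by positivity
        nlinarith [sq_nonneg K]
    _ ≤ (K ^ 2 + 1) * (n * ((K ^ 2 + 1)⁻¹ * (n : ℝ) ^ (2 * b - 1))) := by gcongr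
    _ = n * (n : ℝ) ^ (2 * b - 1) := by field_simp

/-- The existence of a scale `n` with a tent of height `c * L` and slope `c`, high in comparison
with `√(n log log n)`, for which the bounds on the `L^p`-norm of the tent and on the `L^r`-norm
of its increments are small. -/
theorem exists_scale {p r : ℝ} (hp : 0 < p) (hr : 2 ≤ r) (hpr : p < r / (r - 1)) (K : ℝ)
    {ε : ℝ} (hε : 0 < ε) (m : ℕ) :
    ∃ (n L : ℕ) (c : ℝ), m ≤ n ∧ 0 < n ∧ 0 ≤ c ∧ K * √(n * Real.log (Real.log n)) ≤ c * L ∧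
      (c * L) ^ p * ((2 * L + 1) * (2 / n)) ≤ ε ∧ c ^ r * ((2 * L + 1) * (2 / n)) ≤ ε := by
  obtain ⟨a, b, ha, hb, hpab, hrab⟩ := exists_exponents hp hr hpr
  have hlim : ∀ s : ℝ, s < 0 → ∀ᶠ n : ℕ in atTop, 12 * (n : ℝ) ^ s ≤ ε := by
    intro s hs
    have h := ((tendsto_rpow_neg_atTop (neg_pos.2 hs)).comp
      tendsto_natCast_atTop_atTop).const_mul 12
    rw [mul_zero] at h
    simpa using h.eventually_le_const hε
  obtain ⟨n, hmn, hK, h1, h2⟩ := ((eventually_ge_atTop (max m 1)).and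
    ((eventually_mul_sqrt_mul_log_log_le_rpow hb K).and
      ((hlim (b * p + a - 1) (by linarith)).and
        (hlim ((b - a) * r + a - 1) (by linarith))))).exists
  have hn1 : (1 : ℝ) ≤ n := by exact_mod_cast (le_max_right m 1).trans hmn
  have hn0 : (0 : ℝ) < n := by linarith
  have hna : 1 ≤ (n : ℝ) ^ a := Real.one_le_rpow hn1 ha.le
  set L : ℕ := ⌈(n : ℝ) ^ a⌉₊ with hL
  have hLa : (n : ℝ) ^ a ≤ L := Nat.le_ceil _
  have hL0 : (0 : ℝ) < L := by linarith
  -- Since `1 ≤ n ^ a` and `L ≤ n ^ a + 1`, even `10` in place of `12` would do.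
  have hm : (2 * (L : ℝ) + 1) * (2 / n) ≤ 12 * (n : ℝ) ^ (a - 1) := by
    have hL2 : (L : ℝ) < (n : ℝ) ^ a + 1 := Nat.ceil_lt_add_one (by positivity)
    rw [Real.rpow_sub_one hn0.ne', mul_div_assoc', mul_div_assoc']
    exact div_le_div_of_nonneg_right (by linarith) hn0.le
  refine ⟨n, L, (n : ℝ) ^ b / L, (le_max_left m 1).trans hmn, by exact_mod_cast hn0,
    by positivity, ?_, ?_, ?_⟩
  · rwa [div_mul_cancel₀ _ hL0.ne']
  · rw [div_mul_cancel₀ _ hL0.ne', ← Real.rpow_mul hn0.le]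
    calc _ ≤ (n : ℝ) ^ (b * p) * (12 * (n : ℝ) ^ (a - 1)) := by gcongr
      _ = 12 * (n : ℝ) ^ (b * p + a - 1) := by
        rw [mul_left_comm, ← Real.rpow_add hn0, add_sub_assoc]
      _ ≤ ε := h1
  · calc _ ≤ ((n : ℝ) ^ b / (n : ℝ) ^ a) ^ r * (12 * (n : ℝ) ^ (a - 1)) := by gcongr
      _ = 12 * (n : ℝ) ^ ((b - a) * r + a - 1) := by
        rw [← Real.rpow_sub hn0, ← Real.rpow_mul hn0.le, mul_left_comm, ← Real.rpow_add hn0,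
          add_sub_assoc]
      _ ≤ ε := h2

end Parameters

/-! ### Suprema of sequences of functions in `L^p` -/

section Sup

variable {Ω : Type*} [MeasurableSpace Ω] {μ : Measure Ω}

theorem lintegral_iSup_rpow_le {F : ℕ → Ω → ℝ≥0∞} (hF : ∀ k, Measurable (F k)) {p : ℝ}
    (hp : 0 < p) : ∫⁻ x, (⨆ k, F k x) ^ p ∂μ ≤ ∑' k, ∫⁻ x, F k x ^ p ∂μ := by
  rw [← lintegral_tsum fun k ↦ ((hF k).pow_const p).aemeasurable]
  refine lintegral_mono fun x ↦ ?_
  rw [← ENNReal.le_rpow_inv_iff hp]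
  refine iSup_le fun k ↦ ?_
  rw [ENNReal.le_rpow_inv_iff hp]
  exact ENNReal.le_tsum k

theorem memLp_of_enorm_le_iSup {F : ℕ → Ω → ℝ≥0∞} (hF : ∀ k, Measurable (F k)) {p : ℝ}
    (hp : 0 < p) (hsum : ∑' k, ∫⁻ x, F k x ^ p ∂μ ≠ ∞) {g : Ω → ℝ}
    (hg : AEStronglyMeasurable g μ) (hgF : ∀ᵐ x ∂μ, ‖g x‖ₑ ≤ ⨆ k, F k x) :
    MemLp g (ENNReal.ofReal p) μ := by
  refine ⟨hg, ?_⟩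
  rw [eLpNorm_lt_top_iff_lintegral_rpow_enorm_lt_top (by simpa using hp) ENNReal.ofReal_ne_top,
    ENNReal.toReal_ofReal hp.le]
  refine lt_of_le_of_lt ?_ ((lintegral_iSup_rpow_le hF hp).trans_lt hsum.lt_top)
  refine lintegral_mono_ae ?_
  filter_upwards [hgF] with x hx
  gcongr

theorem ae_iSup_lt_top {F : ℕ → Ω → ℝ≥0∞} (hF : ∀ k, Measurable (F k)) {p : ℝ}
    (hp : 0 < p) (hsum : ∑' k, ∫⁻ x, F k x ^ p ∂μ ≠ ∞) : ∀ᵐ x ∂μ, ⨆ k, F k x < ∞ := by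
  have h := ae_lt_top ((Measurable.iSup hF).pow_const p)
    ((lintegral_iSup_rpow_le hF hp).trans_lt hsum.lt_top).ne
  filter_upwards [h] with x hx
  exact (ENNReal.rpow_lt_top_iff_of_pos hp).1 hx

theorem lintegral_rpow_le_of_le_indicator {F : Ω → ℝ≥0∞} {U : Set Ω} (hU : MeasurableSet U)
    {M : ℝ≥0∞} (h : ∀ x, F x ≤ U.indicator (fun _ ↦ M) x) {p : ℝ} (hp : 0 < p) :
    ∫⁻ x, F x ^ p ∂μ ≤ M ^ p * μ U := by
  rw [← lintegral_indicator_const hU]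
  refine lintegral_mono fun x ↦ (ENNReal.rpow_le_rpow (h x) hp.le).trans ?_
  by_cases hx : x ∈ U <;> simp [hx, hp]

end Sup

/-! ### Obstructions to the limit theorems -/

section Obstructions

/-- Along no subsequence can the norms of a sequence converging in distribution tend almost surely
to infinity: the limit law would give mass zero to every ball. -/
theorem not_tendstoInDistribution_of_tendsto_norm {Ω Ω' E : Type*} [MeasurableSpace Ω]
    [MeasurableSpace Ω'] [SeminormedAddCommGroup E] [MeasurableSpace E] [BorelSpace E]
    {μ : Measure Ω} [IsProbabilityMeasure μ] {μ' : Measure Ω'} [IsProbabilityMeasure μ']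
    {X : ℕ → Ω → E} {Z : Ω' → E} (hX : ∀ n, Measurable (X n)) {n : ℕ → ℕ}
    (hn : Tendsto n atTop atTop)
    (hlim : ∀ᵐ ω ∂μ, Tendsto (fun k ↦ ‖X (n k) ω‖) atTop atTop) :
    ¬ TendstoInDistribution X atTop Z (fun _ ↦ μ) μ' := by
  intro h
  have hZ := h.aemeasurable_limit
  have hball : ∀ R : ℝ, μ'.map Z (Metric.ball 0 R) = 0 := by
    intro R
    have h0 : Tendsto (fun k ↦ μ (X (n k) ⁻¹' Metric.ball 0 R)) atTop (𝓝 (μ ∅)) := by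
      refine tendsto_measure_of_ae_tendsto_indicator_of_isFiniteMeasure atTop .empty
        (fun k ↦ hX _ Metric.isOpen_ball.measurableSet) ?_
      filter_upwards [hlim] with ω hω
      filter_upwards [hω.eventually_ge_atTop R] with k hk
      simpa using hk
    have h1 : μ'.map Z (Metric.ball 0 R) ≤
        liminf (fun k ↦ μ.map (X (n k)) (Metric.ball 0 R)) atTop :=
      ProbabilityMeasure.le_liminf_measure_open_of_tendsto (h.tendsto.comp hn) Metric.isOpen_ball
    simp only [fun k ↦ Measure.map_apply (μ := μ) (hX (n k))
      (Metric.isOpen_ball (x := (0 : E)) (ε := R)).measurableSet] at h1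
    rw [h0.liminf_eq, measure_empty] at h1
    exact le_antisymm h1 zero_le
  have huniv : μ'.map Z Set.univ = 0 := by
    rw [← Metric.iUnion_ball_nat (0 : E)]
    exact measure_iUnion_null fun R ↦ hball R
  have := Measure.isProbabilityMeasure_map hZ
  simp at huniv

theorem partialSumPath_div {Ω : Type*} (T : Ω → Ω) (f : Ω → ℝ) {n j : ℕ} (hn : 0 < n)
    (hj : j ≤ n) (ω : Ω) :
    partialSumPath T f n ω ⟨j / n, by positivity,
      div_le_one_of_le₀ (by exact_mod_cast hj) n.cast_nonneg⟩ = birkhoffSum T f j ω := by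
  have hn0 : (n : ℝ) ≠ 0 := by exact_mod_cast hn.ne'
  simp [partialSumPath_apply, mul_div_cancel₀ _ hn0]

theorem birkhoffSum_coboundary {Ω : Type*} (T : Ω → Ω) (g : Ω → ℝ) (n : ℕ) (ω : Ω) :
    birkhoffSum T (fun ω ↦ g ω - g (T ω)) n ω = g ω - g (T^[n] ω) := by
  simp only [birkhoffSum, ← Function.iterate_succ_apply' T]
  simpa using Finset.sum_range_sub' (fun k ↦ g (T^[k] ω)) n

theorem log_pos_of_one_le_log_log {n : ℕ} (h : 1 ≤ Real.log (Real.log n)) : 0 < Real.log n := by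
  refine (Real.log_natCast_nonneg n).lt_of_ne fun h0 ↦ ?_
  rw [← h0, Real.log_zero] at h
  linarith

theorem natCast_one_le_of_one_le_log_log {n : ℕ} (h : 1 ≤ Real.log (Real.log n)) :
    (1 : ℝ) ≤ n := by
  rcases Nat.eq_zero_or_pos n with rfl | hn
  · simp only [CharP.cast_eq_zero, Real.log_zero] at h
    linarith
  · exact_mod_cast hn

variable {Ω : Type*} [MeasurableSpace Ω] {μ : Measure Ω} [IsProbabilityMeasure μ] {T : Ω → Ω}
  {g : Ω → ℝ} {n : ℕ → ℕ}

/-- If the maximum of `g` along the first `n k` points of an orbit is almost surely much larger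
than `√(n k)`, then the partial-sum processes of `g - g ∘ T` are not tight. -/
theorem not_invariancePrinciple (hT : Measurable T) (hg : Measurable g) (hn : ∀ k, k ≤ n k)
    (hlog : ∀ k, 1 ≤ Real.log (Real.log (n k)))
    (hbig : ∀ᵐ ω ∂μ, ∀ k : ℕ, ∃ j < n k,
      k * √(n k * Real.log (Real.log (n k))) ≤ g (T^[j] ω)) :
    ¬ InvariancePrinciple μ T (fun ω ↦ g ω - g (T ω)) := by
  rintro ⟨c, W, _, -, h⟩
  have hmeas (m : ℕ) : Measurable fun ω ↦
      (√(m : ℝ))⁻¹ • partialSumPath T (fun ω ↦ g ω - g (T ω)) m ω := by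
    have hc : Continuous fun x : C(I, ℝ) ↦ (√(m : ℝ))⁻¹ • x := by fun_prop
    exact hc.measurable.comp (measurable_partialSumPath hT (hg.sub (hg.comp hT)) m)
  refine not_tendstoInDistribution_of_tendsto_norm hmeas (tendsto_atTop_mono hn tendsto_id) ?_ h
  filter_upwards [hbig] with ω hω
  have hlin : Tendsto (fun k : ℕ ↦ (k : ℝ) - |g ω|) atTop atTop :=
    tendsto_atTop_add_const_right _ _ tendsto_natCast_atTop_atTop
  refine tendsto_atTop_mono (fun k ↦ ?_) hlin
  obtain ⟨j, hj, hgj⟩ := hω k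
  have hn1 := natCast_one_le_of_one_le_log_log (hlog k)
  have hs1 : 1 ≤ √(n k : ℝ) := Real.one_le_sqrt.2 hn1
  have hk : k * √(n k : ℝ) ≤ g (T^[j] ω) := by
    refine le_trans ?_ hgj
    gcongr
    exact le_mul_of_one_le_right (by positivity) (hlog k)
  refine le_trans ?_ (ContinuousMap.norm_coe_le_norm _ ⟨j / n k, by positivity,
      div_le_one_of_le₀ (by exact_mod_cast hj.le) (n k).cast_nonneg⟩)
  rw [ContinuousMap.smul_apply, partialSumPath_div T _ (by omega) hj.le, birkhoffSum_coboundary,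
    norm_smul, norm_inv, Real.norm_of_nonneg (Real.sqrt_nonneg _), Real.norm_eq_abs, abs_sub_comm,
    le_inv_mul_iff₀ (by positivity)]
  have h1 := neg_abs_le (g ω)
  have h2 := le_abs_self (g (T^[j] ω) - g ω)
  have h3 := le_abs_self (g ω)
  have h4 := mul_le_mul_of_nonneg_right hs1 (abs_nonneg (g ω))
  nlinarith

/-- Values `v j` with `j < n k` much larger than `√(n k log log (n k))` drive the lower limit of
the normalized differences to `-∞`: as each `v j` is finite, the times `j` at which these values
are taken tend to infinity with `k`, and `j log log j ≤ n k log log (n k)`. -/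
theorem frequently_sub_div_sqrt_le {v : ℕ → ℝ} (hlog : ∀ k, 1 ≤ Real.log (Real.log (n k)))
    (hbig : ∀ k : ℕ, ∃ j < n k, k * √(n k * Real.log (Real.log (n k))) ≤ v j) (c : ℝ) :
    ∃ᶠ j : ℕ in atTop, (v 0 - v j) / √(j * Real.log (Real.log j)) ≤ c := by
  have hev : ∀ᶠ j : ℕ in atTop, 1 ≤ Real.log (Real.log j) :=
    (Real.tendsto_log_atTop.comp (Real.tendsto_log_atTop.comp
      tendsto_natCast_atTop_atTop)).eventually_ge_atTop 1
  obtain ⟨m₀, hm₀⟩ := eventually_atTop.1 hev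
  refine frequently_atTop.2 fun m ↦ ?_
  obtain ⟨k, hk⟩ := exists_nat_gt
    (max (|v 0| + |c|) (∑ i ∈ Finset.range (max m m₀), |v i|))
  obtain ⟨hkc, hkv⟩ := max_lt_iff.1 hk
  obtain ⟨j, hj, hvj⟩ := hbig k
  have hn1 := natCast_one_le_of_one_le_log_log (hlog k)
  have hs1 : 1 ≤ √(n k * Real.log (Real.log (n k))) :=
    Real.one_le_sqrt.2 (one_le_mul_of_one_le_of_one_le hn1 (hlog k))
  have hjm : max m m₀ ≤ j := by
    by_contra! hlt
    have h1 : |v j| ≤ ∑ i ∈ Finset.range (max m m₀), |v i| :=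
      Finset.single_le_sum (f := fun i ↦ |v i|) (fun i _ ↦ abs_nonneg _)
        (Finset.mem_range.2 hlt)
    have h2 : (k : ℝ) ≤ k * √(n k * Real.log (Real.log (n k))) :=
      le_mul_of_one_le_right k.cast_nonneg hs1
    linarith [le_abs_self (v j)]
  have hlogj := hm₀ j ((le_max_right _ _).trans hjm)
  have hj1 := natCast_one_le_of_one_le_log_log hlogj
  have hjs : 1 ≤ √(j * Real.log (Real.log j)) :=
    Real.one_le_sqrt.2 (one_le_mul_of_one_le_of_one_le hj1 hlogj)
  have hjn : √(j * Real.log (Real.log j)) ≤ √(n k * Real.log (Real.log (n k))) := by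
    have := log_pos_of_one_le_log_log hlogj
    have hjn' : (j : ℝ) ≤ n k := by exact_mod_cast hj.le
    gcongr
  refine ⟨j, (le_max_left _ _).trans hjm, ?_⟩
  rw [div_le_iff₀ (by linarith)]
  set D := √(j * Real.log (Real.log j))
  have h1 : (|v 0| + |c|) * D ≤ v j := by
    refine le_trans ?_ hvj
    gcongr
  have h2 : |v 0| ≤ |v 0| * D := le_mul_of_one_le_right (abs_nonneg _) hjs
  have h3 : -(|c| * D) ≤ c * D := by
    rw [← neg_mul]
    exact mul_le_mul_of_nonneg_right (neg_abs_le c) (by linarith)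
  linarith [le_abs_self (v 0)]

/-- If the maximum of `g` along the first `n k` points of an orbit is almost surely much larger
than `√(n k log log (n k))`, then the lower limit in the law of the iterated logarithm for
`g - g ∘ T` is almost surely `-∞`, which is not a real number. -/
theorem not_lawOfIteratedLogarithm (hlog : ∀ k, 1 ≤ Real.log (Real.log (n k)))
    (hbig : ∀ᵐ ω ∂μ, ∀ k : ℕ, ∃ j < n k,
      k * √(n k * Real.log (Real.log (n k))) ≤ g (T^[j] ω)) :
    ¬ LawOfIteratedLogarithm μ T (fun ω ↦ g ω - g (T ω)) := by
  rintro ⟨C, h⟩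
  obtain ⟨ω, ⟨-, hinf⟩, hω⟩ := (h.and hbig).exists
  have hfreq := frequently_sub_div_sqrt_le (v := fun j ↦ g (T^[j] ω)) hlog hω (-C - 1)
  have hle := liminf_le_of_frequently_le (f := atTop)
    (u := fun m : ℕ ↦ ((birkhoffSum T (fun ω ↦ g ω - g (T ω)) m ω /
      √(m * Real.log (Real.log m)) : ℝ) : EReal)) (a := ((-C - 1 : ℝ) : EReal))
    (hfreq.mono fun j hj ↦ by
      rw [birkhoffSum_coboundary]
      exact EReal.coe_le_coe_iff.2 hj)
  rw [hinf, EReal.coe_le_coe_iff] at hle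
  linarith

end Obstructions

/-! ### The transfer function -/

section Transfer

variable {Ω : Type*} [MeasurableSpace Ω] {μ : Measure Ω} [IsProbabilityMeasure μ] {T : Ω → Ω}

/-- One tent: a function `F` with small `L^p`-norm, the increments of which along orbits are
dominated by a function `H` with small `L^r`-norm, while the maximum of `F` over the first `n`
points of almost every orbit is at least `K * √(n log log n)`. -/
theorem exists_tent (hT : Ergodic T μ) (haper : IsAperiodic μ T) {p r : ℝ} (hp : 0 < p)
    (hr : 2 ≤ r) (hpr : p < r / (r - 1)) (K : ℝ) {ε : ℝ} (hε : 0 < ε) (m : ℕ) :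
    ∃ (n : ℕ) (F H : Ω → ℝ≥0∞), m ≤ n ∧ Measurable F ∧ Measurable H ∧
      ∫⁻ ω, F ω ^ p ∂μ ≤ ENNReal.ofReal ε ∧ ∫⁻ ω, H ω ^ r ∂μ ≤ ENNReal.ofReal ε ∧
      (∀ ω, F ω ≤ F (T ω) + H ω) ∧ (∀ ω, F (T ω) ≤ F ω + H ω) ∧
      ∀ᵐ ω ∂μ, ∃ j < n,
        ENNReal.ofReal (K * √(n * Real.log (Real.log n))) ≤ F (T^[j] ω) := by
  obtain ⟨n, L, c, hmn, hn, hc, hK, hcp, hcr⟩ := exists_scale hp hr hpr K hε m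
  obtain ⟨B, hB, hBn, hBae⟩ := exists_measure_le_ae_exists_iterate_mem hT haper hn
  have hU := measurableSet_visitBefore hT.measurable hB (2 * L + 1)
  set U := visitBefore T B (2 * L + 1)
  have hμU : μ U ≤ ENNReal.ofReal ((2 * L + 1) * (2 / n)) := by
    refine (measure_visitBefore_le hT.toMeasurePreserving hB _).trans ?_
    have hn0 : (0 : ℝ) < n := by exact_mod_cast hn
    rw [ENNReal.ofReal_mul (by positivity), ENNReal.ofReal_div_of_pos hn0]
    refine mul_le_mul' (le_of_eq ?_) (by simpa using hBn)
    rw [← ENNReal.ofReal_natCast]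
    push_cast
    rfl
  have hint : ∀ (q M : ℝ) (G : Ω → ℝ≥0∞), 0 < q → 0 ≤ M →
      M ^ q * ((2 * L + 1) * (2 / n)) ≤ ε →
      (∀ ω, G ω ≤ U.indicator (fun _ ↦ ENNReal.ofReal M) ω) →
      ∫⁻ ω, G ω ^ q ∂μ ≤ ENNReal.ofReal ε := by
    intro q M G hq hM hMε hG
    refine (lintegral_rpow_le_of_le_indicator hU hG hq).trans ?_
    refine le_trans ?_ (ENNReal.ofReal_le_ofReal hMε)
    rw [ENNReal.ofReal_rpow_of_nonneg hM hq.le, ENNReal.ofReal_mul (by positivity)]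
    gcongr
  have hstep : ∀ {a b : ℕ}, a ≤ b + 1 → ENNReal.ofReal c * a ≤ ENNReal.ofReal c * b +
      ENNReal.ofReal c := by
    intro a b hab
    rw [← mul_add_one]
    gcongr
    exact_mod_cast hab
  refine ⟨n, fun ω ↦ ENNReal.ofReal c * tent T B L ω,
    U.indicator fun _ ↦ ENNReal.ofReal c, hmn, ?_, measurable_const.indicator hU, ?_, ?_, ?_, ?_,
    ?_⟩
  · have := measurable_tent (L := L) hT.measurable hB
    exact ((measurable_from_top (f := fun k : ℕ ↦ (k : ℝ≥0∞))).comp this).const_mul _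
  · refine hint p (c * L) _ hp (by positivity) hcp fun ω ↦ ?_
    by_cases hω : ω ∈ U
    · rw [Set.indicator_of_mem hω, ENNReal.ofReal_mul hc, ENNReal.ofReal_natCast]
      gcongr
      exact tent_le
    · simp [tent_eq_zero hω]
  · exact hint r c _ (by linarith) hc hcr fun ω ↦ le_rfl
  · intro ω
    by_cases hω : ω ∈ U
    · simpa [hω] using hstep (tent_le_tent_apply_add_one (T := T) (B := B) (L := L) (x := ω))
    · simp [tent_eq_zero hω]
  · intro ω
    by_cases hω : ω ∈ U
    · simpa [hω] using hstep (tent_apply_le_tent_add_one (T := T) (B := B) (L := L) (x := ω))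
    · simp [tent_apply_eq_zero hω]
  -- The peak is reached `L` steps before `B`, so the visit of the orbit of `T^[L] ω` is used.
  · have hshift := (hT.toMeasurePreserving.iterate L).quasiMeasurePreserving.ae hBae
    filter_upwards [hshift] with ω ⟨j, hj, hjB⟩
    refine ⟨j, hj, ?_⟩
    rw [tent_eq_of_iterate_mem (by rwa [← Function.iterate_add_apply, add_comm,
      Function.iterate_add_apply]), ← ENNReal.ofReal_natCast, ← ENNReal.ofReal_mul hc]
    exact ENNReal.ofReal_le_ofReal hK

/-- The transfer function is the supremum of a sequence of tents. The supremum exceeds each of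
the tents, and its increments are dominated by the supremum of the bounds on theirs. -/
theorem exists_transfer_function (hT : Ergodic T μ) (haper : IsAperiodic μ T) {p r : ℝ}
    (hp : 0 < p) (hr : 2 ≤ r) (hpr : p < r / (r - 1)) :
    ∃ (g : Ω → ℝ) (n : ℕ → ℕ), Measurable g ∧ MemLp g (ENNReal.ofReal p) μ ∧
      MemLp (fun ω ↦ g ω - g (T ω)) (ENNReal.ofReal r) μ ∧ (∀ k, k ≤ n k) ∧
      (∀ k, 1 ≤ Real.log (Real.log (n k))) ∧
      ∀ᵐ ω ∂μ, ∀ k : ℕ, ∃ j < n k,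
        k * √(n k * Real.log (Real.log (n k))) ≤ g (T^[j] ω) := by
  have hev : ∀ᶠ j : ℕ in atTop, 1 ≤ Real.log (Real.log j) :=
    (Real.tendsto_log_atTop.comp (Real.tendsto_log_atTop.comp
      tendsto_natCast_atTop_atTop)).eventually_ge_atTop 1
  obtain ⟨m₀, hm₀⟩ := eventually_atTop.1 hev
  choose n F H hmn hF hH hFp hHr hFT hTF hbig using fun k : ℕ ↦
    exists_tent hT haper hp hr hpr k (ε := (1 / 2) ^ k) (by positivity) (max k m₀)
  have hsum : ∀ (q : ℝ) (G : ℕ → Ω → ℝ≥0∞),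
      (∀ k, ∫⁻ ω, G k ω ^ q ∂μ ≤ ENNReal.ofReal ((1 / 2) ^ k)) →
      ∑' k, ∫⁻ ω, G k ω ^ q ∂μ ≠ ∞ := fun q G hG ↦
    ne_top_of_le_ne_top summable_geometric_two.tsum_ofReal_ne_top (ENNReal.tsum_le_tsum hG)
  have hr0 : 0 < r := by linarith
  have hfin := ae_iSup_lt_top hF hp (hsum p F hFp)
  have hfin' : ∀ᵐ ω ∂μ, ∀ j, ⨆ k, F k (T^[j] ω) < ∞ := ae_all_iff.2 fun j ↦
    (hT.toMeasurePreserving.iterate j).quasiMeasurePreserving.ae hfin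
  have hHfin := ae_iSup_lt_top hH hr0 (hsum r H hHr)
  have hgm : Measurable fun ω ↦ (⨆ k, F k ω).toReal := (Measurable.iSup hF).ennreal_toReal
  refine ⟨fun ω ↦ (⨆ k, F k ω).toReal, n, hgm, ?_, ?_,
    fun k ↦ (le_max_left _ _).trans (hmn k), fun k ↦ hm₀ _ ((le_max_right _ _).trans (hmn k)), ?_⟩
  · refine memLp_of_enorm_le_iSup hF hp (hsum p F hFp) hgm.aestronglyMeasurable ?_
    filter_upwards with ω
    rw [Real.enorm_of_nonneg ENNReal.toReal_nonneg]
    exact ENNReal.ofReal_toReal_le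
  · refine memLp_of_enorm_le_iSup hH hr0 (hsum r H hHr)
      (hgm.sub (hgm.comp hT.measurable)).aestronglyMeasurable ?_
    filter_upwards [hfin', hHfin] with ω hω hHω
    have h0 : ⨆ k, F k ω ≠ ∞ := (hω 0).ne
    have h1 : ⨆ k, F k (T ω) ≠ ∞ := (hω 1).ne
    have hle : ⨆ k, F k ω ≤ (⨆ k, F k (T ω)) + ⨆ k, H k ω := iSup_le fun k ↦
      (hFT k ω).trans (add_le_add (le_iSup (fun k ↦ F k (T ω)) k) (le_iSup (fun k ↦ H k ω) k))
    have hge : ⨆ k, F k (T ω) ≤ (⨆ k, F k ω) + ⨆ k, H k ω := iSup_le fun k ↦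
      (hTF k ω).trans (add_le_add (le_iSup (fun k ↦ F k ω) k) (le_iSup (fun k ↦ H k ω) k))
    have hle' := ENNReal.toReal_mono (ENNReal.add_ne_top.2 ⟨h1, hHω.ne⟩) hle
    have hge' := ENNReal.toReal_mono (ENNReal.add_ne_top.2 ⟨h0, hHω.ne⟩) hge
    rw [ENNReal.toReal_add h1 hHω.ne] at hle'
    rw [ENNReal.toReal_add h0 hHω.ne] at hge'
    rw [Real.enorm_eq_ofReal_abs, ← ENNReal.ofReal_toReal hHω.ne]
    exact ENNReal.ofReal_le_ofReal (abs_le.2 ⟨by linarith, by linarith⟩)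
  · filter_upwards [hfin', ae_all_iff.2 hbig] with ω hω hbigω k
    obtain ⟨j, hj, hjF⟩ := hbigω k
    refine ⟨j, hj, ?_⟩
    rw [← ENNReal.ofReal_le_iff_le_toReal (hω j).ne]
    exact hjF.trans (le_iSup (fun k ↦ F k (T^[j] ω)) k)

end Transfer

end CoboundaryLimit

theorem theorem2p10 {Ω : Type*} [MeasurableSpace Ω] (μ : Measure Ω) [IsProbabilityMeasure μ]
    (T : Ω ≃ᵐ Ω) (hT : Ergodic T μ) (haper : CoboundaryLimit.IsAperiodic μ T)
    (p r : ℝ) (hp1 : 1 ≤ p) (hp2 : p < 2) (hr : 2 ≤ r) (hpr : p < r / (r - 1)) :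
    ∃ g : Ω → ℝ, Measurable g ∧ MemLp g (ENNReal.ofReal p) μ ∧
      MemLp (fun ω ↦ g ω - g (T ω)) (ENNReal.ofReal r) μ ∧
      ¬ CoboundaryLimit.InvariancePrinciple μ T (fun ω ↦ g ω - g (T ω)) ∧
      ¬ CoboundaryLimit.LawOfIteratedLogarithm μ T (fun ω ↦ g ω - g (T ω)) := by
  obtain ⟨g, n, hg, hgp, hgr, hn, hlog, hbig⟩ :=
    CoboundaryLimit.exists_transfer_function hT haper (by linarith) hr hpr
  exact ⟨g, hg, hgp, hgr, CoboundaryLimit.not_invariancePrinciple hT.measurable hg hn hlog hbig,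
    CoboundaryLimit.not_lawOfIteratedLogarithm hlog hbig⟩
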